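/- An edge-weighted graph $(G,w)$ is a finite undirected simple graph $G$ with nonnegative edge weights $w$; $\delta_G(u,v)\in[0,\infty]$ is the least total weight of a path from $u$ to $v$ ($\infty$ if there is none). For $P,F\subseteq V(G)$, an $\epsilon$-scattering in $(P,F,\delta_G)$ is a sequence $(x_1,p_1),\dots,(x_\ell,p_\ell)\in F\times P$ with $\delta_G(x_i,p_j)\le 1$ for all $1\le j<i\le \ell$ and $\delta_G(x_i,p_i)>1+\epsilon$ for all $i$; the $\epsilon$-scatter dimension of $(P,F,\delta_G)$ is the maximum length $\ell$ of such a sequence. Theorem 1.3. There is an absolute constant $C\in\mathbb N$ such that for every $\epsilon\in(0,1)$, every integer $\mathrm{tw}\ge 0$, every edge-weighted graph $(G,w)$ of treewidth at most $\mathrm{tw}$ and all $P,F\subseteq V(G)$, the $\epsilon$-scatter dimension of $(P,F,\delta_G)$ is at most $$\exp\left((2/\epsilon)^{C\cdot \mathrm{tw}}\right)$$ and also at most $$\max(\mathrm{tw},2)^{(2/\epsilon)^{C\cdot \mathrm{tw}}}.$$ (For $\epsilon\le 1/2$ one has $2/\epsilon\le(1/\epsilon)^2$, so these are bounds of the form $\exp((1/\epsilon)^{O(\mathrm{tw})})$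 and, for $\mathrm{tw}\ge2$, $\mathrm{tw}^{(1/\epsilon)^{O(\mathrm{tw})}}$.) -/

import Mathlib

open scoped NNReal ENNReal

/-- A tree decomposition of `G` whose underlying tree has node set `ι`. -/
structure SimpleGraph.TreeDecomposition {V : Type*} (G : SimpleGraph V) (ι : Type*) where
  tree : SimpleGraph ι
  isTree : tree.IsTree
  bag : ι → Set V
  vertex_mem : ∀ v, ∃ t, v ∈ bag t
  edge_mem : ∀ u v, G.Adj u v → ∃ t, u ∈ bag t ∧ v ∈ bag t
  connected : ∀ v, (tree.induce {t | v ∈ bag t}).Connected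

/-- The width: largest bag size minus one (the empty graph gets width `0`). -/
noncomputable def SimpleGraph.TreeDecomposition.width {V ι : Type*} {G : SimpleGraph V}
    (D : G.TreeDecomposition ι) : ℕ∞ :=
  (⨆ t, (D.bag t).encard) - 1

/-- The treewidth: the minimum width over all tree decompositions; every finite tree is
isomorphic to one whose node set is `Fin n`. -/
noncomputable def SimpleGraph.treewidth {V : Type*} (G : SimpleGraph V) : ℕ∞ :=
  ⨅ (n : ℕ) (D : G.TreeDecomposition (Fin n)), D.width

/-- Shortest-path distance in the graph `G` with nonnegative edge weights `w`: the infimum of the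
total weights of all walks from `u` to `v`; it is `∞` if there is none. (As weights are
nonnegative, deleting closed subwalks shows that walks and paths give the same value.) -/
noncomputable def SimpleGraph.weightedDist {V : Type*} (G : SimpleGraph V) (w : Sym2 V → ℝ≥0)
    (u v : V) : ℝ≥0∞ :=
  ⨅ p : G.Walk u v, (((p.edges.map w).sum : ℝ≥0) : ℝ≥0∞)

/-- The sequence `(x 0, p 0), …, (x (ℓ-1), p (ℓ-1))` of pairs in `F × P` is an `ε`-scattering in
the space `(P, F, δ)`. -/
structure IsScattering {V : Type*} (P F : Set V) (δ : V → V → ℝ≥0∞) (ε : ℝ) {ℓ : ℕ}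
    (x p : Fin ℓ → V) : Prop where
  center_mem : ∀ i, x i ∈ F
  point_mem : ∀ i, p i ∈ P
  covering : ∀ i j, j < i → δ (x i) (p j) ≤ 1
  refutation : ∀ i, ENNReal.ofReal (1 + ε) < δ (x i) (p i)

/-- The `ε`-scatter dimension of `(P, F, δ)`: the supremum of the lengths of its
`ε`-scatterings. -/
noncomputable def scatterDim {V : Type*} (P F : Set V) (δ : V → V → ℝ≥0∞) (ε : ℝ) : ℕ∞ :=
  ⨆ (ℓ : ℕ) (_ : ∃ x p : Fin ℓ → V, IsScattering P F δ ε x p), (ℓ : ℕ∞)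

/-!
A scattering in a graph of treewidth `k` has length at most `2 ^ ((2 / ε) ^ (17 k))`; both bounds
follow, as `2 ≤ exp 1` and `2 ≤ max k 2`. For `k = 0` the graph has no edges and the length is at
most `2`. Let `k ≥ 1`.

Fix a rooted tree decomposition. A bag `S` has at most `k + 1` vertices and gates the vertices of
the subtree below it from all others: shortest paths between the two sides pass through `S`. Round
distances to multiples of `1 / n`, where `n = ⌈3 / ε⌉`, so that there are at most
`q = (n + 2) ^ (k + 1)` distance profiles of vertices at `S`. The basic observation
(`not_gated_of_bucket_eq`) is that if `j < i` and `p j`, `p i` have the same profile at `S`, then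
`S` does not gate `x i` from `p j`: otherwise the path from `x i` to `p j` could be rerouted to
`p i`.

This forces the indices of a long scattering to move together down the tree: among those whose
points have the same profile at a bag, all but the first and the last go to the same child
(`exists_child_of_card_le`). Descending, and losing a factor `8 q ^ 3` at each step, one finds
(`exists_tooth`, `exists_comb`) nested gates `S 0, S 1, …` along a branch of the tree and indices
`i 0, i 1, …`, monotone increasing or decreasing, such that `x (i t)` and `p (i t)` lie between
`S t` and `S (t + 1)` and all `x (i u)` with `u ≥ t` have the same profile at `S t`, and so have
all `p (i u)`. As distances are symmetric, the decreasing case becomes the increasing one when the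
roles of `x` and `p` are exchanged. A logarithm of the length has now been spent.

It remains to see that such a comb has at most `(n + 2) ^ (k + 2)` teeth (`IsComb.length_le`).
A shortest path from a late center to an early point passes through all the gates between them,
and on a proportion `1 / (n + 2)` of them it moves by no more than `1 / n`. Repeating the argument
`k + 2` times inside nested windows of gates gives `k + 2` such paths crossing the same gate. Two
of them would have to cross it in the same vertex, and this would make some `x i` too close to
`p i` (`exists_card_eq_of_comb`).
-/

/-! ### Shortest-path distances -/

namespace SimpleGraph

variable {V : Type*} {G : SimpleGraph V} {w : Sym2 V → ℝ≥0}

theorem weightedDist_le_of_walk {u v : V} (p : G.Walk u v) :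
    G.weightedDist w u v ≤ (((p.edges.map w).sum : ℝ≥0) : ℝ≥0∞) :=
  iInf_le _ p

theorem weightedDist_self (u : V) : G.weightedDist w u u = 0 :=
  le_antisymm (by simpa using weightedDist_le_of_walk (w := w) (Walk.nil : G.Walk u u)) zero_le

theorem weightedDist_comm (u v : V) : G.weightedDist w u v = G.weightedDist w v u := by
  have key : ∀ u v : V, G.weightedDist w u v ≤ G.weightedDist w v u := fun u v =>
    le_iInf fun p => by
      simpa [Walk.edges_reverse, List.sum_reverse] using
        weightedDist_le_of_walk (w := w) p.reverse
  exact le_antisymm (key u v) (key v u)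

theorem weightedDist_triangle (u v x : V) :
    G.weightedDist w u x ≤ G.weightedDist w u v + G.weightedDist w v x := by
  change _ ≤ (⨅ p : G.Walk u v, _) + ⨅ q : G.Walk v x, _
  rw [ENNReal.iInf_add]
  refine le_iInf fun p => ?_
  rw [ENNReal.add_iInf]
  refine le_iInf fun q => ?_
  simpa using weightedDist_le_of_walk (w := w) (p.append q)

end SimpleGraph

/-- The set `S` gates `u` from `v`: unless `v` is unreachable from `u`, some shortest path from
`u` to `v` passes through `S`. -/
def Gated {V : Type*} (δ : V → V → ℝ≥0∞) (S : Set V) (u v : V) : Prop :=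
  δ u v ≠ ⊤ → ∃ z ∈ S, δ u z + δ z v ≤ δ u v

theorem Gated.symm {V : Type*} {δ : V → V → ℝ≥0∞} (hcomm : ∀ u v, δ u v = δ v u) {S : Set V}
    {u v : V} (h : Gated δ S u v) : Gated δ S v u := by
  intro hne
  obtain ⟨z, hz, h⟩ := h (by rwa [hcomm])
  exact ⟨z, hz, by rwa [hcomm v z, hcomm z u, hcomm v u, add_comm]⟩

/-- A finite set that meets every walk from `u` to `v` gates `u` from `v`. -/
theorem SimpleGraph.gated_of_forall_walk {V : Type*} {G : SimpleGraph V} {w : Sym2 V → ℝ≥0}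
    {S : Set V} (hS : S.Finite) {u v : V} (h : ∀ p : G.Walk u v, ∃ z ∈ p.support, z ∈ S) :
    Gated (G.weightedDist w) S u v := by
  classical
  intro hne
  have hwalk : ∀ p : G.Walk u v, ∃ z ∈ S, G.weightedDist w u z + G.weightedDist w z v ≤
      (((p.edges.map w).sum : ℝ≥0) : ℝ≥0∞) := by
    intro p
    obtain ⟨z, hz, hzS⟩ := h p
    refine ⟨z, hzS, ?_⟩
    calc _ ≤ ((((p.takeUntil z hz).edges.map w).sum : ℝ≥0) : ℝ≥0∞) +
          ((((p.dropUntil z hz).edges.map w).sum : ℝ≥0) : ℝ≥0∞) :=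
          add_le_add (weightedDist_le_of_walk _) (weightedDist_le_of_walk _)
      _ = _ := by
          rw [← ENNReal.coe_add, ← List.sum_append, ← List.map_append, ← Walk.edges_append,
            Walk.take_spec]
  have hSne : S.Nonempty := by
    by_contra hS'
    rw [Set.not_nonempty_iff_eq_empty] at hS'
    refine hne (iInf_eq_top.2 fun p => ?_)
    obtain ⟨z, -, hz⟩ := h p
    simp [hS'] at hz
  obtain ⟨z, hz, hmin⟩ := Set.exists_min_image S
    (fun z => G.weightedDist w u z + G.weightedDist w z v) hS hSne
  refine ⟨z, hz, le_iInf fun p => ?_⟩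
  obtain ⟨z', hz', h'⟩ := hwalk p
  exact (hmin z' hz').trans h'

/-! ### Rooted trees -/

/-- Every tree has, for each choice of a root `r`, a parent function with which its edges are the
pairs of a node and its parent; `rk` is the distance from the root. -/
theorem SimpleGraph.IsTree.exists_parent {ι : Type*} {T : SimpleGraph ι} (hT : T.IsTree) (r : ι) :
    ∃ (par : ι → ι) (rk : ι → ℕ), (∀ t, par t ≠ t → rk t = rk (par t) + 1) ∧
      (∀ t, ∃ m, par^[m] t = r) ∧ ∀ t t', T.Adj t t' → par t = t' ∨ par t' = t := by
  classical
  choose P hP hPu using fun t => hT.existsUnique_path r t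
  have hstep : ∀ t t', T.Adj t t' → T.dist r t = T.dist r t' + 1 → (P t).penultimate = t' := by
    intro t t' hadj hd
    obtain ⟨p, hp⟩ := (hT.connected r t').exists_walk_length_eq_dist
    have hp' : (p.concat hadj.symm).IsPath := by
      apply Walk.isPath_of_length_eq_dist
      rw [Walk.length_concat, hp, hd]
    rw [← hPu t _ hp', Walk.penultimate_concat]
  have hpar : ∀ t, t ≠ r → T.dist r t = T.dist r (P t).penultimate + 1 := by
    intro t ht
    obtain ⟨p, hp⟩ := (hT.connected r t).exists_walk_length_eq_dist
    have hpP : p = P t := hPu t p (Walk.isPath_of_length_eq_dist p hp)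
    have hnil : ¬ (P t).Nil := fun h => ht h.eq.symm
    have h1 := (P t).adj_penultimate hnil
    rcases hT.dist_eq_dist_add_one_of_adj r h1 with h | h
    · exfalso
      have h2 : T.dist r (P t).penultimate ≤ (P t).dropLast.length := dist_le _
      have h3 : (P t).length = T.dist r t := by rw [← hpP, hp]
      have h4 : (P t).dropLast.length ≤ (P t).length := by
        simp [Walk.dropLast]
      omega
    · exact h
  refine ⟨fun t => (P t).penultimate, T.dist r, fun t ht => hpar t ?_, ?_, ?_⟩
  · rintro rfl
    exact ht (congrArg Walk.penultimate (hPu t Walk.nil Walk.IsPath.nil)).symm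
  · have : ∀ d t, T.dist r t = d → ∃ m, (fun t => (P t).penultimate)^[m] t = r := by
      intro d
      induction d with
      | zero => exact fun t ht => ⟨0, ((hT.connected r t).dist_eq_zero_iff.1 ht).symm⟩
      | succ d ih =>
        intro t ht
        have htr : t ≠ r := by rintro rfl; simp at ht
        obtain ⟨m, hm⟩ := ih (P t).penultimate (by have := hpar t htr; omega)
        exact ⟨m + 1, hm⟩
    exact fun t => this _ t rfl
  · intro t t' hadj
    rcases hT.dist_eq_dist_add_one_of_adj r hadj with h | h
    · exact Or.inl (hstep t t' hadj h)
    · exact Or.inr (hstep t' t hadj.symm h)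

/-- The nodes of the subtree rooted at `c`, in the rooted tree with parent function `par`. -/
def descendants {ι : Type*} (par : ι → ι) (c : ι) : Set ι := {t | ∃ m, par^[m] t = c}

section descendants

variable {ι : Type*} {par : ι → ι}

theorem self_mem_descendants (c : ι) : c ∈ descendants par c := ⟨0, rfl⟩

theorem descendants_subset {c K : ι} (h : K ∈ descendants par c) :
    descendants par K ⊆ descendants par c := by
  rintro t ⟨m, hm⟩
  obtain ⟨n, hn⟩ := h
  exact ⟨n + m, by rw [Function.iterate_add_apply, hm, hn]⟩

theorem mem_descendants_of_parent {c t : ι} (h : par t ∈ descendants par c) :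
    t ∈ descendants par c := by
  obtain ⟨m, hm⟩ := h
  exact ⟨m + 1, hm⟩

theorem parent_mem_descendants {c t : ι} (h : t ∈ descendants par c) (hne : t ≠ c) :
    par t ∈ descendants par c := by
  obtain ⟨_ | m, hm⟩ := h
  · exact absurd hm hne
  · exact ⟨m, hm⟩

theorem exists_child {c t : ι} (h : t ∈ descendants par c) (hne : t ≠ c) :
    ∃ K, K ≠ c ∧ par K = c ∧ t ∈ descendants par K := by
  classical
  have hpos : Nat.find h ≠ 0 := fun h0 => hne (by simpa [h0] using Nat.find_spec h)
  obtain ⟨m, hm⟩ := Nat.exists_eq_succ_of_ne_zero hpos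
  refine ⟨par^[m] t, Nat.find_min h (by omega), ?_, m, rfl⟩
  have hspec := Nat.find_spec h
  rwa [hm, Function.iterate_succ_apply'] at hspec

end descendants

/-- If every tree edge leaving the node set `U` has an endpoint at `c`, then the bag at `c` meets
every walk from a vertex in a bag inside `U` to a vertex in a bag outside `U`. -/
theorem SimpleGraph.TreeDecomposition.exists_mem_bag_of_walk {V ι : Type*} {G : SimpleGraph V}
    (D : G.TreeDecomposition ι) {U : Set ι} {c : ι}
    (hU : ∀ t t', D.tree.Adj t t' → t ∈ U → t' ∉ U → t = c ∨ t' = c) {u v : V} (p : G.Walk u v)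
    {t₁ t₂ : ι} (hu : u ∈ D.bag t₁) (ht₁ : t₁ ∈ U) (hv : v ∈ D.bag t₂) (ht₂ : t₂ ∉ U) :
    ∃ z ∈ p.support, z ∈ D.bag c := by
  have straddle : ∀ (x : V) (t₁ t₂ : ι), x ∈ D.bag t₁ → t₁ ∈ U → x ∈ D.bag t₂ → t₂ ∉ U →
      x ∈ D.bag c := by
    intro x t₁ t₂ h₁ hU₁ h₂ hU₂
    obtain ⟨q⟩ := (D.connected x).preconnected ⟨t₁, h₁⟩ ⟨t₂, h₂⟩
    obtain ⟨d, -, hd₁, hd₂⟩ := q.exists_boundary_dart {t | t.1 ∈ U} hU₁ hU₂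
    rcases hU _ _ d.adj hd₁ hd₂ with h | h
    · exact h ▸ d.fst.2
    · exact h ▸ d.snd.2
  induction p generalizing t₁ with
  | nil => exact ⟨_, by simp, straddle _ t₁ t₂ hu ht₁ hv ht₂⟩
  | @cons a b _ hadj q ih =>
    obtain ⟨t, hat, hbt⟩ := D.edge_mem _ _ hadj
    by_cases ht : t ∈ U
    · obtain ⟨z, hz, hzc⟩ := ih hbt ht hv
      exact ⟨z, by simp [hz], hzc⟩
    · exact ⟨a, by simp, straddle a t₁ t hu ht₁ hat ht⟩

/-! ### Rounded distance profiles -/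

/-- The distance `a` rounded down to a multiple of `1 / n` (the value returned is `⌊n a⌋`), all
distances above `1` being identified; there are `n + 2` possible values. -/
noncomputable def bucket (n : ℕ) (a : ℝ≥0∞) : ℕ :=
  open Classical in if a ≤ 1 then ⌊(n : ℝ) * a.toReal⌋₊ else n + 1

theorem bucket_le_iff {n : ℕ} {a : ℝ≥0∞} : bucket n a ≤ n ↔ a ≤ 1 := by
  unfold bucket
  split_ifs with h
  · refine iff_of_true ?_ h
    have h1 : a.toReal ≤ 1 := by
      simpa using ENNReal.toReal_mono ENNReal.one_ne_top h
    refine Nat.floor_le_of_le ?_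
    nlinarith [Nat.cast_nonneg (α := ℝ) n]
  · exact iff_of_false (by omega) h

theorem bucket_lt (n : ℕ) (a : ℝ≥0∞) : bucket n a < n + 2 := by
  by_cases h : a ≤ 1
  · have := (bucket_le_iff (n := n)).2 h
    omega
  · simp [bucket, h]

theorem le_one_of_bucket_eq {n : ℕ} {a b : ℝ≥0∞} (h : bucket n a = bucket n b) (hb : b ≤ 1) :
    a ≤ 1 := by
  rw [← bucket_le_iff (n := n)] at hb ⊢
  rwa [h]

theorem le_add_of_bucket_eq {n : ℕ} (hn : n ≠ 0) {a b : ℝ≥0∞} (h : bucket n a = bucket n b)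
    (hb : b ≤ 1) : a ≤ b + (n : ℝ≥0∞)⁻¹ := by
  have ha := le_one_of_bucket_eq h hb
  have ha' : a ≠ ⊤ := ne_top_of_le_ne_top ENNReal.one_ne_top ha
  have hb' : b ≠ ⊤ := ne_top_of_le_ne_top ENNReal.one_ne_top hb
  have hn0 : (0 : ℝ) < n := by positivity
  have hr : a.toReal ≤ b.toReal + (n : ℝ)⁻¹ := by
    simp only [bucket, ha, hb, if_true] at h
    have h1 := Nat.lt_floor_add_one ((n : ℝ) * a.toReal)
    have h2 := Nat.floor_le (a := (n : ℝ) * b.toReal) (by positivity)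
    rw [h] at h1
    have h3 : (n : ℝ) * a.toReal ≤ n * (b.toReal + (n : ℝ)⁻¹) := by
      rw [mul_add, mul_inv_cancel₀ hn0.ne']
      linarith
    exact le_of_mul_le_mul_left h3 hn0
  have hninv : (n : ℝ≥0∞)⁻¹ ≠ ⊤ := by simp [hn]
  rw [← ENNReal.toReal_le_toReal ha' (ENNReal.add_ne_top.2 ⟨hb', hninv⟩),
    ENNReal.toReal_add hb' hninv]
  simpa using hr

/-- Pigeonhole principle for rounded distance profiles: there are at most `(n + 2) ^ (k + 1)`
profiles at a set of at most `k + 1` vertices. -/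
theorem exists_same_profile {V κ : Type*} (δ : V → V → ℝ≥0∞) (n k : ℕ) {S : Set V}
    (hS : S.encard ≤ (k + 1 : ℕ)) (f : κ → V) {I : Finset κ} {m : ℕ}
    (hm : (n + 2) ^ (k + 1) * m ≤ I.card) :
    ∃ I' ⊆ I, m ≤ I'.card ∧
      ∀ i ∈ I', ∀ j ∈ I', ∀ z ∈ S, bucket n (δ (f i) z) = bucket n (δ (f j) z) := by
  classical
  have hfin : S.Finite := Set.finite_of_encard_le_coe hS
  have := hfin.fintype
  have hcard : Fintype.card (S → Fin (n + 2)) ≤ (n + 2) ^ (k + 1) := by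
    rw [Fintype.card_fun, Fintype.card_fin]
    refine Nat.pow_le_pow_right (by omega) ?_
    rw [Set.encard_eq_coe_toFinset_card, Set.toFinset_card] at hS
    exact_mod_cast hS
  let g : κ → S → Fin (n + 2) := fun i z => ⟨bucket n (δ (f i) z), bucket_lt _ _⟩
  obtain ⟨y, -, hy⟩ := Finset.exists_le_card_fiber_of_mul_le_card_of_maps_to (s := I)
    (t := Finset.univ) (f := g) (n := m) (fun _ _ => Finset.mem_univ _) Finset.univ_nonempty
    ((Nat.mul_le_mul_right m (by simpa using hcard)).trans hm)
  refine ⟨I.filter (fun i => g i = y), Finset.filter_subset _ _, hy, ?_⟩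
  intro i hi j hj z hz
  have h : g i = g j := by
    rw [(Finset.mem_filter.1 hi).2, (Finset.mem_filter.1 hj).2]
  exact congrArg Fin.val (congrFun h ⟨z, hz⟩)

/-! ### Hierarchies of small gates -/

/-- The metric content of a rooted tree decomposition of width at most `k`, with node set `ι`.
For the subtree rooted at a node `c`, the set `core c` consists of the vertices assigned to a node
of the subtree (each vertex being assigned to one node whose bag contains it), and `hull c` is the
union of the bags of the subtree; `rank c` is the depth of `c`. By the field `child`, each vertex
of the core of `c` lies in the bag of `c` or in the core of a child of `c` which the bag of `c`
gates from the complement. -/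
structure GatedHierarchy {V : Type*} (δ : V → V → ℝ≥0∞) (k : ℕ) (ι : Type*) where
  core : ι → Set V
  hull : ι → Set V
  bag : ι → Set V
  rank : ι → ℕ
  encard_bag_le : ∀ c, (bag c).encard ≤ (k + 1 : ℕ)
  exists_core_eq_univ : ∃ r, core r = Set.univ
  core_subset_hull : ∀ c, core c ⊆ hull c
  bag_subset_hull : ∀ c, bag c ⊆ hull c
  gated : ∀ c, ∀ u ∈ hull c, ∀ v ∉ core c, Gated δ (bag c) u v
  child : ∀ c, ∀ u ∈ core c, u ∈ bag c ∨ ∃ K, rank c < rank K ∧ core K ⊆ core c ∧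
    hull K ⊆ hull c ∧ u ∈ core K ∧ ∀ u' ∈ core K, ∀ v ∉ core K, Gated δ (bag c) u' v

theorem SimpleGraph.exists_gatedHierarchy {V : Type*} [Finite V] {G : SimpleGraph V}
    (w : Sym2 V → ℝ≥0) {k : ℕ} {ι : Type*} (D : G.TreeDecomposition ι)
    (hD : ∀ t, (D.bag t).encard ≤ (k + 1 : ℕ)) :
    Nonempty (GatedHierarchy (G.weightedDist w) k ι) := by
  obtain ⟨r⟩ := D.isTree.connected.nonempty
  obtain ⟨par, rk, hrk, hroot, hadj⟩ := D.isTree.exists_parent r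
  choose home hhome using D.vertex_mem
  have hleave : ∀ c t t', D.tree.Adj t t' → t ∈ descendants par c → t' ∉ descendants par c →
      t = c ∧ par t = t' := by
    intro c t t' h ht ht'
    rcases hadj t t' h with h | h
    · refine ⟨?_, h⟩
      by_contra hne
      exact ht' (h ▸ parent_mem_descendants ht hne)
    · exact absurd (mem_descendants_of_parent (h.symm ▸ ht)) ht'
  exact ⟨{
    core := fun c => {v | home v ∈ descendants par c}
    hull := fun c => {v | ∃ t ∈ descendants par c, v ∈ D.bag t}
    bag := D.bag
    rank := rk
    encard_bag_le := hD
    exists_core_eq_univ := ⟨r, Set.eq_univ_of_forall fun v => hroot _⟩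
    core_subset_hull := fun c v hv => ⟨home v, hv, hhome v⟩
    bag_subset_hull := fun c v hv => ⟨c, self_mem_descendants c, hv⟩
    gated := by
      rintro c u ⟨t, ht, hut⟩ v hv
      exact gated_of_forall_walk (Set.toFinite _) fun p =>
        D.exists_mem_bag_of_walk (fun t t' h h1 h2 => Or.inl (hleave c t t' h h1 h2).1) p hut ht
          (hhome v) hv
    child := by
      intro c u hu
      by_cases huc : home u = c
      · exact Or.inl (huc ▸ hhome u)
      · obtain ⟨K, hKc, hK, huK⟩ := exists_child hu huc
        have hKr : K ∈ descendants par c := mem_descendants_of_parent (hK ▸ self_mem_descendants _)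
        refine Or.inr ⟨K, ?_, fun v hv => descendants_subset hKr hv,
          fun v ⟨t, ht, hv⟩ => ⟨t, descendants_subset hKr ht, hv⟩, huK, ?_⟩
        · rw [hrk K (by rw [hK]; exact hKc.symm), hK]
          exact Nat.lt_succ_self _
        · intro u' hu' v hv
          refine gated_of_forall_walk (Set.toFinite _) fun p =>
            D.exists_mem_bag_of_walk (U := descendants par K) (fun t t' h h1 h2 => Or.inr ?_) p
              (hhome u') hu' (hhome v) hv
          obtain ⟨rfl, h⟩ := hleave K t t' h h1 h2
          rw [← h, hK] }⟩

/-! ### Combs -/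

/-- The laws of a pseudometric with values in `[0, ∞]`. -/
structure IsPseudoEDist {V : Type*} (δ : V → V → ℝ≥0∞) : Prop where
  self : ∀ u, δ u u = 0
  comm : ∀ u v, δ u v = δ v u
  triangle : ∀ u v z, δ u z ≤ δ u v + δ v z

section comb

variable {V ι κ : Type*} {δ : V → V → ℝ≥0∞} {k : ℕ}

/-- The relation between an earlier tooth `e` and a later tooth `f` of a comb: the gate of `f`
lies below the gate of `e` and cuts off the point of `e`, the two centers have the same distance
profile at the gate of `e`, and the center of `f` covers the point of `e`. -/
structure CombRel (H : GatedHierarchy δ k ι) (n : ℕ) (x p : κ → V) (e f : κ × ι) : Prop where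
  notMem_core : p e.1 ∉ H.core f.2
  hull_subset : H.hull f.2 ⊆ H.hull e.2
  bucket_eq : ∀ z ∈ H.bag e.2, bucket n (δ (x f.1) z) = bucket n (δ (x e.1) z)
  dist_le : δ (x f.1) (p e.1) ≤ 1

/-- A comb is a list of teeth, each consisting of an index `i` (which stands for the center `x i`
and the point `p i`, at distance more than `1 + 3 / n`) and a node of the hierarchy, whose hull
contains `x i`; any two teeth are related by `CombRel`. -/
structure IsComb (H : GatedHierarchy δ k ι) (n : ℕ) (x p : κ → V) (L : List (κ × ι)) : Prop where
  pairwise : L.Pairwise (CombRel H n x p)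
  mem_hull : ∀ e ∈ L, x e.1 ∈ H.hull e.2
  far : ∀ e ∈ L, 1 + 3 * (n : ℝ≥0∞)⁻¹ < δ (x e.1) (p e.1)

theorem IsComb.cons {H : GatedHierarchy δ k ι} {n : ℕ} {x p : κ → V} {L : List (κ × ι)}
    (hL : IsComb H n x p L) {i₀ : κ} {c K : ι} {J : Finset κ}
    (hin : ∀ e ∈ L, e.1 ∈ J ∧ H.core e.2 ⊆ H.core K ∧ H.hull e.2 ⊆ H.hull K)
    (hhull : H.hull K ⊆ H.hull c) (hx₀ : x i₀ ∈ H.hull c) (hp₀ : p i₀ ∉ H.core K)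
    (hprof : ∀ i ∈ J, ∀ z ∈ H.bag c, bucket n (δ (x i) z) = bucket n (δ (x i₀) z))
    (hnear : ∀ i ∈ J, δ (x i) (p i₀) ≤ 1) (hfar : 1 + 3 * (n : ℝ≥0∞)⁻¹ < δ (x i₀) (p i₀)) :
    IsComb H n x p ((i₀, c) :: L) where
  pairwise := List.pairwise_cons.2 ⟨fun e he =>
    ⟨fun h => hp₀ ((hin e he).2.1 h), (hin e he).2.2.trans hhull, hprof _ (hin e he).1,
      hnear _ (hin e he).1⟩, hL.pairwise⟩
  mem_hull := List.forall_mem_cons.2 ⟨hx₀, hL.mem_hull⟩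
  far := List.forall_mem_cons.2 ⟨hfar, hL.far⟩

/-- A shortest path from `u` to `q` can be routed through all the gates `c (α + j), …, c (α + 1)`
between `u` and `q`, in this order. -/
theorem exists_geodesic_chain (hδ : IsPseudoEDist δ) (H : GatedHierarchy δ k ι) {c : ℕ → ι}
    {q : V} {α N : ℕ} (hc : ∀ s t, α ≤ s → s < t → t < N → H.hull (c t) ⊆ H.hull (c s))
    (hq : ∀ t, α < t → t < N → q ∉ H.core (c t)) (j : ℕ) (hj : α + j < N) (u : V)
    (hu : u ∈ H.hull (c (α + j))) (huq : δ u q ≠ ⊤) :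
    ∃ y : ℕ → V, ∀ t, α < t → t ≤ α + j → y t ∈ H.bag (c t) ∧
      δ u (y t) + δ (y t) q ≤ δ u q ∧
      ∀ t', t ≤ t' → t' ≤ α + j → δ (y t') (y t) + δ (y t) q ≤ δ (y t') q := by
  induction j generalizing u with
  | zero => exact ⟨fun _ => u, fun t h1 h2 => by omega⟩
  | succ j ih =>
    obtain ⟨z, hz, hzle⟩ := H.gated (c (α + (j + 1))) u hu q (hq _ (by omega) hj) huq
    have hzq : δ z q ≠ ⊤ := ne_top_of_le_ne_top huq (le_add_self.trans hzle)
    obtain ⟨y, hy⟩ := ih (by omega) z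
      (hc (α + j) (α + (j + 1)) (by omega) (by omega) hj (H.bag_subset_hull _ hz)) hzq
    refine ⟨Function.update y (α + (j + 1)) z, fun t h1 h2 => ?_⟩
    rcases h2.eq_or_lt with rfl | h2
    · refine ⟨by simpa using hz, by simpa using hzle, fun t' h3 h4 => ?_⟩
      obtain rfl : t' = α + (j + 1) := le_antisymm h4 h3
      simp [hδ.self]
    · obtain ⟨hy1, hy2, hy3⟩ := hy t h1 (by omega)
      rw [Function.update_of_ne h2.ne]
      refine ⟨hy1, ?_, fun t' h3 h4 => ?_⟩
      · calc δ u (y t) + δ (y t) q ≤ δ u z + δ z (y t) + δ (y t) q := by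
              gcongr; exact hδ.triangle _ _ _
          _ ≤ δ u z + δ z q := by rw [add_assoc]; gcongr
          _ ≤ δ u q := hzle
      · rcases h4.eq_or_lt with rfl | h4
        · simpa using hy2
        · rw [Function.update_of_ne h4.ne]
          exact hy3 t' h3 (by omega)

/-- In a window of `(n + 2) ^ r` gates of a comb there is a gate with `r` distinct vertices `z`
each of which lies on a path of length at most `1` from some later center to some earlier point of
the window.

For the induction step, route a shortest path from the last center of the window to its first
point through all the gates. By the pigeonhole principle, the routing vertices `y t` move by at most
`1 / n` on some window of length `(n + 2) ^ r`. The `r` vertices obtained in this smaller window are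
different from `y t`, since otherwise some point `p m` would be as close to `y t` as the first
point, whence `x m`, which has the same distance to `y m` as the last center, would be too close
to `p m`. -/
theorem exists_card_eq_of_comb (hδ : IsPseudoEDist δ) (H : GatedHierarchy δ k ι) {n : ℕ}
    (hn : n ≠ 0) {x p : κ → V} {e : ℕ → κ × ι} {N : ℕ}
    (hrel : ∀ s t, s < t → t < N → CombRel H n x p (e s) (e t))
    (hmem : ∀ t < N, x (e t).1 ∈ H.hull (e t).2)
    (hfar : ∀ t < N, 1 + 3 * (n : ℝ≥0∞)⁻¹ < δ (x (e t).1) (p (e t).1)) (r : ℕ) :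
    ∀ α, α + (n + 2) ^ r < N → ∃ t, α ≤ t ∧ t ≤ α + (n + 2) ^ r ∧ ∃ Z : Finset V, Z.card = r ∧
      ∀ z ∈ Z, z ∈ H.bag (e t).2 ∧ ∃ m i, α ≤ m ∧ m < t ∧ t ≤ i ∧ i < N ∧
        δ (x (e i).1) z + δ z (p (e m).1) ≤ 1 := by
  classical
  induction r with
  | zero => exact fun α _ => ⟨α, le_rfl, by omega, ∅, rfl, by simp⟩
  | succ r ih =>
    intro α hα
    have hpow : (n + 2) ^ (r + 1) = (n + 1) * (n + 2) ^ r + (n + 2) ^ r := by ring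
    have hpos : 0 < (n + 2) ^ r := by positivity
    set l := (n + 2) ^ r with hl
    set β := α + (n + 2) ^ (r + 1) with hβ
    have hαβ : α < β := by omega
    set q := p (e α).1 with hqdef
    have hβq : δ (x (e β).1) q ≤ 1 := (hrel α β hαβ hα).dist_le
    obtain ⟨y, hy⟩ := exists_geodesic_chain hδ H (c := fun t => (e t).2) (q := q) (α := α) (N := N)
      (fun s t _ hst htN => (hrel s t hst htN).hull_subset)
      (fun t h1 h2 => (hrel α t h1 h2).notMem_core) ((n + 2) ^ (r + 1)) hα (x (e β).1) (hmem β hα)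
      (ne_top_of_le_ne_top ENNReal.one_ne_top hβq)
    have hy1 : ∀ t, α < t → t ≤ β → δ (x (e β).1) (y t) + δ (y t) q ≤ 1 :=
      fun t h1 h2 => (hy t h1 h2).2.1.trans hβq
    have hyq : ∀ t, α < t → t ≤ β → δ (y t) q ≤ 1 :=
      fun t h1 h2 => le_add_self.trans (hy1 t h1 h2)
    have hmono : ∀ t t', α < t → t ≤ t' → t' ≤ β → δ (y t) q ≤ δ (y t') q :=
      fun t t' h1 h2 h3 => le_add_self.trans ((hy t h1 (h2.trans h3)).2.2 t' h2 h3)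
    -- The boundaries of `n + 1` consecutive windows of length `l`.
    let T : ℕ → ℕ := fun b => α + 1 + b * l
    have hT : ∀ b, b ≤ n + 1 → α < T b ∧ T b ≤ β := by
      intro b hb
      have : b * l ≤ (n + 1) * l := Nat.mul_le_mul_right l hb
      simp only [T]
      omega
    obtain ⟨b, hb, b', hb', hbb, hbucket⟩ : ∃ b ∈ Finset.range (n + 2), ∃ b' ∈ Finset.range (n + 2),
        b < b' ∧ bucket n (δ (y (T b')) q) = bucket n (δ (y (T b)) q) := by
      obtain ⟨b, hb, b', hb', hne, h⟩ := Finset.exists_ne_map_eq_of_card_lt_of_maps_to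
        (s := Finset.range (n + 2)) (t := Finset.range (n + 1))
        (f := fun b => bucket n (δ (y (T b)) q)) (by simp) (fun b hb => by
          have hb : b ≤ n + 1 := by simpa [Nat.lt_succ_iff] using hb
          have := bucket_le_iff (n := n).2 (hyq (T b) (hT b hb).1 (hT b hb).2)
          simpa [Nat.lt_succ_iff] using this)
      rcases hne.lt_or_gt with h' | h'
      · exact ⟨b, hb, b', hb', h', h.symm⟩
      · exact ⟨b', hb', b, hb, h', h⟩
    have hb : b ≤ n + 1 := by simpa [Nat.lt_succ_iff] using hb
    have hb' : b' ≤ n + 1 := by simpa [Nat.lt_succ_iff] using hb'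
    obtain ⟨ha1, -⟩ := hT b hb
    obtain ⟨-, ha2⟩ := hT b' hb'
    set a := T b with ha
    have hab : a + l ≤ T b' := by
      have : (b + 1) * l ≤ b' * l := Nat.mul_le_mul_right l hbb
      simp only [ha, T]
      linarith
    have hclose : ∀ t t', a ≤ t → t ≤ t' → t' ≤ a + l → δ (y t') (y t) ≤ (n : ℝ≥0∞)⁻¹ := by
      intro t t' h1 h2 h3
      have h4 : δ (y t') (y t) + δ (y t) q ≤ (n : ℝ≥0∞)⁻¹ + δ (y t) q :=
        calc _ ≤ δ (y t') q := (hy t (by omega) (by omega)).2.2 t' h2 (by omega)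
          _ ≤ δ (y (T b')) q := hmono _ _ (by omega) (by omega) ha2
          _ ≤ δ (y a) q + (n : ℝ≥0∞)⁻¹ :=
            le_add_of_bucket_eq hn hbucket (hyq a ha1 (by omega))
          _ ≤ δ (y t) q + (n : ℝ≥0∞)⁻¹ := by gcongr; exact hmono _ _ ha1 h1 (by omega)
          _ = _ := add_comm _ _
      exact (ENNReal.add_le_add_iff_right
        (ne_top_of_le_ne_top ENNReal.one_ne_top (hyq t (by omega) (by omega)))).1 h4
    obtain ⟨t, hat, hta, Z, hZ, hZprop⟩ := ih a (by omega)
    have hyZ : y t ∉ Z := by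
      intro hmemZ
      obtain ⟨-, m, i, ham, hmt, hti, hiN, hle⟩ := hZprop _ hmemZ
      have hym := (hy m (by omega) (by omega)).1
      have h1 : δ (x (e β).1) (y m) ≤ 1 := le_self_add.trans (hy1 m (by omega) (by omega))
      have hbi := (hrel m i (by omega) hiN).bucket_eq _ hym
      have hbβ := (hrel m β (by omega) hα).bucket_eq _ hym
      have h2 : δ (x (e i).1) (y m) ≤ 1 := le_one_of_bucket_eq (hbi.trans hbβ.symm) h1
      refine (hfar m (by omega)).not_ge ?_
      calc δ (x (e m).1) (p (e m).1)
          ≤ δ (x (e m).1) (y m) + (δ (y m) (y t) + δ (y t) (p (e m).1)) :=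
            (hδ.triangle _ (y m) _).trans (by gcongr; exact hδ.triangle _ _ _)
        _ ≤ (δ (x (e i).1) (y t) + (n : ℝ≥0∞)⁻¹ + (n : ℝ≥0∞)⁻¹) +
              ((n : ℝ≥0∞)⁻¹ + δ (y t) (p (e m).1)) := by
            have h3 := hclose m t ham hmt.le hta
            gcongr
            · refine (le_add_of_bucket_eq hn hbi.symm h2).trans ?_
              gcongr
              exact (hδ.triangle _ (y t) _).trans (by gcongr)
            · rwa [hδ.comm]
        _ = (δ (x (e i).1) (y t) + δ (y t) (p (e m).1)) + 3 * (n : ℝ≥0∞)⁻¹ := by ring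
        _ ≤ 1 + 3 * (n : ℝ≥0∞)⁻¹ := by gcongr
    refine ⟨t, by omega, by omega, insert (y t) Z, by rw [Finset.card_insert_of_notMem hyZ, hZ],
      fun z hz => ?_⟩
    rcases Finset.mem_insert.1 hz with rfl | hz
    · exact ⟨(hy t (by omega) (by omega)).1, α, β, le_rfl, by omega, by omega, hα,
        hy1 t (by omega) (by omega)⟩
    · obtain ⟨h1, m, i, h2, h3, h4, h5, h6⟩ := hZprop z hz
      exact ⟨h1, m, i, by omega, h3, h4, h5, h6⟩

/-- Otherwise some bag would contain `k + 2` vertices. -/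
theorem IsComb.length_le (hδ : IsPseudoEDist δ) {H : GatedHierarchy δ k ι} {n : ℕ} (hn : n ≠ 0)
    {x p : κ → V} {L : List (κ × ι)} (hL : IsComb H n x p L) : L.length ≤ (n + 2) ^ (k + 2) := by
  by_contra! hlt
  have hne : 0 < L.length := by omega
  let e : ℕ → κ × ι := fun t => L.getD t L[0]
  have he : ∀ t (ht : t < L.length), e t = L[t] := fun t ht => List.getD_eq_getElem _ _ ht
  obtain ⟨t, -, ht, Z, hZ, hZprop⟩ := exists_card_eq_of_comb hδ H hn (x := x) (p := p) (e := e)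
    (N := L.length)
    (fun s t hst ht => by
      rw [he s (hst.trans ht), he t ht]
      exact List.pairwise_iff_getElem.1 hL.pairwise s t _ _ hst)
    (fun t ht => by rw [he t ht]; exact hL.mem_hull _ (List.getElem_mem _))
    (fun t ht => by rw [he t ht]; exact hL.far _ (List.getElem_mem _)) (k + 2) 0 (by simpa using hlt)
  have h1 : (Z : Set V).encard ≤ (H.bag (e t).2).encard :=
    Set.encard_le_encard fun z hz => (hZprop z hz).1
  have h2 := h1.trans (H.encard_bag_le _)
  rw [Set.encard_coe_eq_coe_finsetCard, hZ] at h2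
  have h3 : k + 2 ≤ k + 1 := by exact_mod_cast h2
  omega

end comb

/-! ### Extracting combs from long scatterings -/

section extraction

variable {V ι κ : Type*} [LinearOrder κ] {δ : V → V → ℝ≥0∞} {k : ℕ}

/-- If `j < i` and the points `p j`, `p i` have the same profile at a set that gates `x i` from
`p j`, then `x i` is about as close to `p i` as to `p j`. -/
theorem not_gated_of_bucket_eq (hδ : IsPseudoEDist δ) {n : ℕ} (hn : n ≠ 0) {x p : κ → V}
    (hnear : ∀ i j, j < i → δ (x i) (p j) ≤ 1)
    (hfar : ∀ i, 1 + 3 * (n : ℝ≥0∞)⁻¹ < δ (x i) (p i)) {S : Set V} {i j : κ} (hji : j < i)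
    (hp : ∀ z ∈ S, bucket n (δ (p i) z) = bucket n (δ (p j) z)) : ¬ Gated δ S (x i) (p j) := by
  intro hg
  have h1 := hnear i j hji
  obtain ⟨z, hz, hle⟩ := hg (ne_top_of_le_ne_top ENNReal.one_ne_top h1)
  have h2 : δ (p j) z ≤ 1 := by rw [hδ.comm]; exact le_add_self.trans (hle.trans h1)
  refine (hfar i).not_ge ?_
  calc δ (x i) (p i) ≤ δ (x i) z + δ (p i) z := by rw [hδ.comm (p i)]; exact hδ.triangle _ _ _
    _ ≤ δ (x i) z + (δ (p j) z + (n : ℝ≥0∞)⁻¹) := by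
        gcongr; exact le_add_of_bucket_eq hn (hp z hz) h2
    _ = (δ (x i) z + δ z (p j)) + (n : ℝ≥0∞)⁻¹ := by rw [hδ.comm (p j), add_assoc]
    _ ≤ 1 + (n : ℝ≥0∞)⁻¹ := by gcongr; exact hle.trans h1
    _ ≤ 1 + 3 * (n : ℝ≥0∞)⁻¹ := by
        gcongr
        exact le_mul_of_one_le_left zero_le (by norm_num)

/-- If some set of at most `k + 1` vertices gates all centers from all points, then there are few
indices. -/
theorem card_lt_of_gated (hδ : IsPseudoEDist δ) {n : ℕ} (hn : n ≠ 0) {x p : κ → V}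
    (hnear : ∀ i j, j < i → δ (x i) (p j) ≤ 1)
    (hfar : ∀ i, 1 + 3 * (n : ℝ≥0∞)⁻¹ < δ (x i) (p i)) {S : Set V}
    (hS : S.encard ≤ (k + 1 : ℕ)) {J : Finset κ}
    (hJ : ∀ i ∈ J, ∀ j ∈ J, Gated δ S (x i) (p j)) : J.card < (n + 2) ^ (k + 1) * 2 := by
  by_contra! h
  obtain ⟨I, hIJ, hI, hprof⟩ := exists_same_profile δ n k hS p h
  obtain ⟨i, hi, j, hj, hne⟩ := Finset.one_lt_card.1 hI
  rcases hne.lt_or_gt with hij | hij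
  · exact not_gated_of_bucket_eq hδ hn hnear hfar hij (hprof j hj i hi)
      (hJ j (hIJ hj) i (hIJ hi))
  · exact not_gated_of_bucket_eq hδ hn hnear hfar hij (hprof i hi j hj)
      (hJ i (hIJ hi) j (hIJ hj))

/-- At every node `c`, some child of `c` retains a proportion `1 / (n + 2) ^ (k + 1)` of the
indices: among those whose points have the same profile at the bag of `c`, all but the first and
the last one lie together in the core of a child. -/
theorem exists_child_of_card_le (hδ : IsPseudoEDist δ) (H : GatedHierarchy δ k ι) {n : ℕ}
    (hn : n ≠ 0) {x p : κ → V} (hnear : ∀ i j, j < i → δ (x i) (p j) ≤ 1)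
    (hfar : ∀ i, 1 + 3 * (n : ℝ≥0∞)⁻¹ < δ (x i) (p i)) (c : ι) {I : Finset κ}
    (hI : ∀ i ∈ I, x i ∈ H.core c ∧ p i ∈ H.core c) {m : ℕ} (hm : 0 < m)
    (hcard : (n + 2) ^ (k + 1) * (m + 2) ≤ I.card) :
    ∃ K, H.rank c < H.rank K ∧ H.core K ⊆ H.core c ∧ H.hull K ⊆ H.hull c ∧ ∃ J ⊆ I, m ≤ J.card ∧
      ∀ i ∈ J, x i ∈ H.core K ∧ p i ∈ H.core K := by
  obtain ⟨J, hJI, hJ, hprof⟩ := exists_same_profile δ n k (H.encard_bag_le c) p hcard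
  have hne : J.Nonempty := Finset.card_pos.1 (by omega)
  have hng : ∀ i ∈ J, ∀ j ∈ J, j < i → ¬ Gated δ (H.bag c) (x i) (p j) := fun i hi j hj hji =>
    not_gated_of_bucket_eq hδ hn hnear hfar hji (hprof i hi j hj)
  set a := J.min' hne with ha
  set b := J.max' hne with hb
  have haJ : a ∈ J := J.min'_mem hne
  have hbJ : b ∈ J := J.max'_mem hne
  have hab : a < b := Finset.min'_lt_max'_of_card J (by omega)
  rcases H.child c (x b) (hI b (hJI hbJ)).1 with hxb | ⟨K, hrank, hcore, hhull, hxK, hgate⟩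
  · exact absurd (fun _ => ⟨x b, hxb, by simp [hδ.self]⟩) (hng b hbJ a haJ hab)
  have hp : ∀ j ∈ J, j < b → p j ∈ H.core K := by
    intro j hj hjb
    by_contra hcon
    exact hng b hbJ j hj hjb (hgate _ hxK _ hcon)
  have hx : ∀ i ∈ J, a < i → x i ∈ H.core K := by
    intro i hi hai
    by_contra hcon
    exact hng i hi a haJ hai ((hgate _ (hp a haJ hab) _ hcon).symm hδ.comm)
  refine ⟨K, hrank, hcore, hhull, (J.erase a).erase b,
    (Finset.erase_subset _ _).trans ((Finset.erase_subset _ _).trans hJI), ?_, ?_⟩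
  · rw [Finset.card_erase_of_mem (Finset.mem_erase.2 ⟨hab.ne', hbJ⟩), Finset.card_erase_of_mem haJ]
    omega
  · intro i hi
    obtain ⟨hib, hi⟩ := Finset.mem_erase.1 hi
    obtain ⟨hia, hi⟩ := Finset.mem_erase.1 hi
    exact ⟨hx i hi (lt_of_le_of_ne (J.min'_le i hi) (Ne.symm hia)),
      hp i hi (lt_of_le_of_ne (J.le_max' i hi) hib)⟩

/-- One step of the construction of a comb: an index `i₀` lying outside the core of a node `K`
below `c`, and many indices inside it, all of them after `i₀` or all of them before `i₀`, with
the same profiles at the bag of `c` as `i₀`. -/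
theorem exists_tooth [Finite ι] (hδ : IsPseudoEDist δ) (H : GatedHierarchy δ k ι) {n : ℕ}
    (hn : n ≠ 0) {x p : κ → V} (hnear : ∀ i j, j < i → δ (x i) (p j) ≤ 1)
    (hfar : ∀ i, 1 + 3 * (n : ℝ≥0∞)⁻¹ < δ (x i) (p i)) (c : ι) {I : Finset κ}
    (hI : ∀ i ∈ I, x i ∈ H.core c ∧ p i ∈ H.core c) {m : ℕ} (hm : 0 < m)
    (hcard : 8 * ((n + 2) ^ (k + 1)) ^ 3 * m ≤ I.card) :
    ∃ K, H.core K ⊆ H.core c ∧ H.hull K ⊆ H.hull c ∧ ∃ i₀ ∈ I, x i₀ ∉ H.core K ∧ p i₀ ∉ H.core K ∧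
      ∃ J ⊆ I, m ≤ J.card ∧
        (∀ i ∈ J, x i ∈ H.core K ∧ p i ∈ H.core K) ∧
        (∀ i ∈ J, ∀ z ∈ H.bag c, bucket n (δ (x i) z) = bucket n (δ (x i₀) z)) ∧
        (∀ i ∈ J, ∀ z ∈ H.bag c, bucket n (δ (p i) z) = bucket n (δ (p i₀) z)) ∧
        ((∀ i ∈ J, i₀ < i) ∨ ∀ i ∈ J, i < i₀) := by
  classical
  set Q := (n + 2) ^ (k + 1) with hQ
  have hQpos : 0 < Q := by positivity
  obtain ⟨I₁, hI₁, hcard₁, hprof₁⟩ := exists_same_profile δ n k (H.encard_bag_le c) x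
    (m := 8 * Q ^ 2 * m) (I := I) (by rw [← hQ]; refine le_trans (le_of_eq ?_) hcard; ring)
  obtain ⟨I₂, hI₂, hcard₂, hprof₂⟩ := exists_same_profile δ n k (H.encard_bag_le c) p
    (m := 8 * Q * m) (I := I₁) (by rw [← hQ]; refine le_trans (le_of_eq ?_) hcard₁; ring)
  -- A deepest node whose core retains at least half of the indices in `I₂`.
  let inside : ι → Finset κ := fun d => I₂.filter fun i => x i ∈ H.core d ∧ p i ∈ H.core d
  let W : Set ι := {d | H.core d ⊆ H.core c ∧ H.hull d ⊆ H.hull c ∧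
    I₂.card ≤ 2 * (inside d).card}
  have hcW : c ∈ W := by
    refine ⟨subset_rfl, subset_rfl, ?_⟩
    have : inside c = I₂ := Finset.filter_true_of_mem fun i hi => hI i (hI₁ (hI₂ hi))
    rw [this]
    omega
  obtain ⟨d, ⟨hdcore, hdhull, hdcard⟩, hdmax⟩ :=
    Set.exists_max_image W H.rank (Set.toFinite _) ⟨c, hcW⟩
  obtain ⟨K, hrank, hcore, hhull, J, hJ, hJcard, hJcore⟩ :=
    exists_child_of_card_le hδ H hn hnear hfar d (I := inside d) (m := 2 * m)
      (fun i hi => (Finset.mem_filter.1 hi).2) (by omega) (by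
        rw [← hQ]
        have h1 : Q * (2 * m + 2) ≤ 4 * Q * m := by nlinarith
        have h2 : 8 * Q * m = 2 * (4 * Q * m) := by ring
        omega)
  have hKsmall : 2 * (inside K).card < I₂.card := by
    by_contra! hcon
    exact (hdmax K ⟨hcore.trans hdcore, hhull.trans hdhull, hcon⟩).not_gt hrank
  -- Few indices straddle the core of `K`: its bag gates their centers from their points.
  obtain ⟨i₀, hi₀, hx₀, hp₀⟩ : ∃ i ∈ I₂, x i ∉ H.core K ∧ p i ∉ H.core K := by
    by_contra! hcon
    set J₁ := I₂.filter fun i => x i ∈ H.core K ∧ p i ∉ H.core K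
    set J₂ := I₂.filter fun i => x i ∉ H.core K ∧ p i ∈ H.core K
    have hcover : I₂ ⊆ inside K ∪ (J₁ ∪ J₂) := by
      intro i hi
      have := hcon i hi
      simp only [inside, J₁, J₂, Finset.mem_union, Finset.mem_filter]
      tauto
    have h1 := Finset.card_le_card hcover
    have h2 := Finset.card_union_le (inside K) (J₁ ∪ J₂)
    have h3 := Finset.card_union_le J₁ J₂
    have h4 : J₁.card < Q * 2 :=
      card_lt_of_gated hδ hn hnear hfar (H.encard_bag_le K) fun i hi j hj =>
        H.gated K _ (H.core_subset_hull K (Finset.mem_filter.1 hi).2.1) _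
          (Finset.mem_filter.1 hj).2.2
    have h5 : J₂.card < Q * 2 :=
      card_lt_of_gated hδ hn hnear hfar (H.encard_bag_le K) fun i hi j hj =>
        (H.gated K _ (H.core_subset_hull K (Finset.mem_filter.1 hj).2.2) _
          (Finset.mem_filter.1 hi).2.1).symm hδ.comm
    have h6 : 8 * Q ≤ 8 * Q * m := Nat.le_mul_of_pos_right _ hm
    omega
  have hJI₂ : J ⊆ I₂ := hJ.trans (Finset.filter_subset _ _)
  have hsplit : J.card = (J.filter fun i => i₀ < i).card + (J.filter fun i => ¬ i₀ < i).card :=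
    (Finset.card_filter_add_card_filter_not _).symm
  have hside : ∃ J' ⊆ J, m ≤ J'.card ∧ ((∀ i ∈ J', i₀ < i) ∨ ∀ i ∈ J', i < i₀) := by
    rcases le_or_gt m (J.filter fun i => i₀ < i).card with h | h
    · exact ⟨_, Finset.filter_subset _ _, h, Or.inl fun i hi => (Finset.mem_filter.1 hi).2⟩
    · refine ⟨J.filter fun i => ¬ i₀ < i, Finset.filter_subset _ _, by omega,
        Or.inr fun i hi => ?_⟩
      obtain ⟨hi1, hi2⟩ := Finset.mem_filter.1 hi
      refine lt_of_le_of_ne (not_lt.1 hi2) ?_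
      rintro rfl
      exact hx₀ (hJcore i hi1).1
  obtain ⟨J', hJ'J, hJ'card, hJ'side⟩ := hside
  refine ⟨K, hcore.trans hdcore, hhull.trans hdhull, i₀, hI₁ (hI₂ hi₀), hx₀, hp₀, J',
    hJ'J.trans (hJI₂.trans (hI₂.trans hI₁)), hJ'card, fun i hi => hJcore i (hJ'J hi),
    fun i hi => hprof₁ i (hI₂ (hJI₂ (hJ'J hi))) i₀ (hI₂ hi₀),
    fun i hi => hprof₂ i (hJI₂ (hJ'J hi)) i₀ hi₀, hJ'side⟩

/-- A scattering of length exponential in `a + b` contains a comb with `a` teeth, whose indices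
increase, or a comb with `b` teeth for the exchanged roles of centers and points, whose indices
decrease. -/
theorem exists_comb [Finite ι] (hδ : IsPseudoEDist δ) (H : GatedHierarchy δ k ι) {n : ℕ}
    (hn : n ≠ 0) {x p : κ → V} (hnear : ∀ i j, j < i → δ (x i) (p j) ≤ 1)
    (hfar : ∀ i, 1 + 3 * (n : ℝ≥0∞)⁻¹ < δ (x i) (p i)) (a b : ℕ) (c : ι) (I : Finset κ)
    (hI : ∀ i ∈ I, x i ∈ H.core c ∧ p i ∈ H.core c)
    (hcard : (8 * ((n + 2) ^ (k + 1)) ^ 3) ^ (a + b) ≤ I.card) :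
    (∃ L, IsComb H n x p L ∧ L.length = a ∧
      ∀ e ∈ L, e.1 ∈ I ∧ H.core e.2 ⊆ H.core c ∧ H.hull e.2 ⊆ H.hull c) ∨
    ∃ L, IsComb H n p x L ∧ L.length = b ∧
      ∀ e ∈ L, e.1 ∈ I ∧ H.core e.2 ⊆ H.core c ∧ H.hull e.2 ⊆ H.hull c := by
  induction hs : a + b generalizing a b c I with
  | zero => exact Or.inl ⟨[], ⟨.nil, by simp, by simp⟩, by simp; omega, by simp⟩
  | succ s ih =>
    rcases a with _ | a
    · exact Or.inl ⟨[], ⟨.nil, by simp, by simp⟩, rfl, by simp⟩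
    rcases b with _ | b
    · exact Or.inr ⟨[], ⟨.nil, by simp, by simp⟩, rfl, by simp⟩
    obtain ⟨K, hcore, hhull, i₀, hi₀, hx₀, hp₀, J, hJ, hJcard, hJcore, hprofx, hprofp, hside⟩ :=
      exists_tooth hδ H hn hnear hfar c hI (m := (8 * ((n + 2) ^ (k + 1)) ^ 3) ^ s)
        (by positivity) (by rw [hs, pow_succ'] at hcard; exact hcard)
    have lift : ∀ L : List (κ × ι),
        (∀ e ∈ L, e.1 ∈ J ∧ H.core e.2 ⊆ H.core K ∧ H.hull e.2 ⊆ H.hull K) →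
        ∀ e ∈ L, e.1 ∈ I ∧ H.core e.2 ⊆ H.core c ∧ H.hull e.2 ⊆ H.hull c := fun L hL e he =>
      ⟨hJ (hL e he).1, (hL e he).2.1.trans hcore, (hL e he).2.2.trans hhull⟩
    rcases hside with hside | hside
    · rcases ih a (b + 1) K J hJcore
        (by rwa [show a + (b + 1) = s by omega]) (by omega) with
        ⟨L, hL, hlen, hin⟩ | ⟨L, hL, hlen, hin⟩
      · refine Or.inl ⟨(i₀, c) :: L, hL.cons hin hhull (H.core_subset_hull c (hI i₀ hi₀).1) hp₀
          hprofx (fun i hi => hnear _ _ (hside i hi)) (hfar i₀), by simp [hlen],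
          List.forall_mem_cons.2 ⟨⟨hi₀, subset_rfl, subset_rfl⟩, lift L hin⟩⟩
      · exact Or.inr ⟨L, hL, hlen, lift L hin⟩
    · rcases ih (a + 1) b K J hJcore
        (by rwa [show a + 1 + b = s by omega]) (by omega) with
        ⟨L, hL, hlen, hin⟩ | ⟨L, hL, hlen, hin⟩
      · exact Or.inl ⟨L, hL, hlen, lift L hin⟩
      · refine Or.inr ⟨(i₀, c) :: L, hL.cons hin hhull (H.core_subset_hull c (hI i₀ hi₀).2) hx₀
          hprofp (fun i hi => by rw [hδ.comm]; exact hnear _ _ (hside i hi))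
          (by rw [hδ.comm]; exact hfar i₀), by simp [hlen],
          List.forall_mem_cons.2 ⟨⟨hi₀, subset_rfl, subset_rfl⟩, lift L hin⟩⟩

/-- A scattering in a space with a hierarchy of gates of size at most `k + 1` is short. -/
theorem length_lt_of_gatedHierarchy [Finite ι] (hδ : IsPseudoEDist δ) (H : GatedHierarchy δ k ι)
    {n : ℕ} (hn : n ≠ 0) {l : ℕ} {x p : Fin l → V} (hnear : ∀ i j, j < i → δ (x i) (p j) ≤ 1)
    (hfar : ∀ i, 1 + 3 * (n : ℝ≥0∞)⁻¹ < δ (x i) (p i)) :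
    l < (8 * ((n + 2) ^ (k + 1)) ^ 3) ^ (2 * ((n + 2) ^ (k + 2) + 1)) := by
  by_contra! hle
  obtain ⟨r, hr⟩ := H.exists_core_eq_univ
  rcases exists_comb hδ H hn hnear hfar ((n + 2) ^ (k + 2) + 1) ((n + 2) ^ (k + 2) + 1) r
    Finset.univ (by simp [hr]) (by rw [← two_mul]; simpa using hle) with
    ⟨L, hL, hlen, -⟩ | ⟨L, hL, hlen, -⟩
  · have := hL.length_le hδ hn
    omega
  · have := hL.length_le hδ hn
    omega

end extraction

/-! ### The bound for graphs of bounded treewidth -/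

theorem SimpleGraph.isPseudoEDist_weightedDist {V : Type*} (G : SimpleGraph V) (w : Sym2 V → ℝ≥0) :
    IsPseudoEDist (G.weightedDist w) :=
  ⟨weightedDist_self, weightedDist_comm, weightedDist_triangle⟩

theorem SimpleGraph.exists_treeDecomposition_of_treewidth_le {V : Type*} {G : SimpleGraph V}
    {k : ℕ} (h : G.treewidth ≤ k) :
    ∃ (m : ℕ) (D : G.TreeDecomposition (Fin m)), ∀ t, (D.bag t).encard ≤ (k + 1 : ℕ) := by
  have hlt : G.treewidth < ((k + 1 : ℕ) : ℕ∞) := h.trans_lt (by exact_mod_cast Nat.lt_succ_self k)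
  unfold treewidth at hlt
  simp only [iInf_lt_iff] at hlt
  obtain ⟨m, D, hD⟩ := hlt
  refine ⟨m, D, fun t => (le_iSup (fun t => (D.bag t).encard) t).trans ?_⟩
  have hD' : D.width ≤ k := by
    rw [Nat.cast_add, Nat.cast_one] at hD
    exact Order.le_of_lt_add_one hD
  have := tsub_le_iff_right.1 hD'
  exact_mod_cast this

/-- A graph of treewidth `0` has no edges, so that only distances from a vertex to itself are
finite. -/
theorem IsScattering.length_le_two {V : Type*} {G : SimpleGraph V} {w : Sym2 V → ℝ≥0}
    {P F : Set V} {ε : ℝ} (hG : G.treewidth ≤ (0 : ℕ)) {l : ℕ} {x p : Fin l → V}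
    (h : IsScattering P F (G.weightedDist w) ε x p) : l ≤ 2 := by
  obtain ⟨m, D, hD⟩ := SimpleGraph.exists_treeDecomposition_of_treewidth_le hG
  have hadj : ∀ u v, ¬ G.Adj u v := by
    intro u v huv
    obtain ⟨t, hu, hv⟩ := D.edge_mem u v huv
    exact huv.ne (Set.encard_le_one_iff.1 (by simpa using hD t) u v hu hv)
  have heq : ∀ u v, G.weightedDist w u v ≤ 1 → u = v := by
    intro u v huv
    by_contra hne
    have hemp : IsEmpty (G.Walk u v) := ⟨fun q => by
      cases q with
      | nil => exact hne rfl
      | cons h _ => exact hadj _ _ h⟩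
    rw [SimpleGraph.weightedDist, iInf_of_empty] at huv
    simp at huv
  by_contra! hl
  let i₀ : Fin l := ⟨0, by omega⟩
  let i₁ : Fin l := ⟨1, by omega⟩
  let i₂ : Fin l := ⟨2, by omega⟩
  have h₁ := heq _ _ (h.covering i₁ i₀ (by simp [i₁, i₀]))
  have h₂ := heq _ _ (h.covering i₂ i₀ (by simp [i₂, i₀]))
  have h₃ := heq _ _ (h.covering i₂ i₁ (by simp [i₂, i₁]))
  have h₄ := h.refutation i₁
  rw [h₁, ← h₂, h₃, SimpleGraph.weightedDist_self] at h₄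
  exact not_lt_zero h₄

/-- With `B = 2 / ε` and `n = ⌈3 / ε⌉`, the left-hand side is at most a power of `B` whose
exponent is `B ^ O(k)`; the base becomes `2` by `B ≤ 2 ^ B`. -/
theorem two_rpow_bound {B : ℝ} (hB : 2 < B) {n k : ℕ} (hk : 1 ≤ k) (hn : (n : ℝ) + 2 ≤ 3 * B) :
    (((8 * ((n + 2) ^ (k + 1)) ^ 3) ^ (2 * ((n + 2) ^ (k + 2) + 1)) : ℕ) : ℝ) ≤
      (2 : ℝ) ^ (B ^ (17 * k)) := by
  have hB1 : 1 ≤ B := by linarith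
  have hB0 : 0 ≤ B := by linarith
  have hn3 : ((n + 2 : ℕ) : ℝ) ≤ B ^ 3 := by
    have h1 : 3 ≤ B ^ 2 := by nlinarith
    calc ((n + 2 : ℕ) : ℝ) ≤ 3 * B := by exact_mod_cast hn
      _ ≤ B ^ 2 * B := by gcongr
      _ = B ^ 3 := by ring
  have h8 : (8 : ℝ) ≤ B ^ 3 := by
    calc (8 : ℝ) = 2 ^ 3 := by norm_num
      _ ≤ B ^ 3 := by gcongr
  have hbase : ((8 * ((n + 2) ^ (k + 1)) ^ 3 : ℕ) : ℝ) ≤ B ^ (9 * k + 12) := by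
    calc ((8 * ((n + 2) ^ (k + 1)) ^ 3 : ℕ) : ℝ) = 8 * (((n + 2 : ℕ) : ℝ) ^ (k + 1)) ^ 3 := by
          push_cast; ring
      _ ≤ B ^ 3 * ((B ^ 3) ^ (k + 1)) ^ 3 := by gcongr
      _ = B ^ (9 * k + 12) := by ring
  set E := 2 * ((n + 2) ^ (k + 2) + 1) with hE
  have hexp : (E : ℝ) ≤ B ^ (3 * k + 8) := by
    have h1 : 1 ≤ (B ^ 3) ^ (k + 2) := one_le_pow₀ (one_le_pow₀ hB1)
    calc (E : ℝ) = 2 * (((n + 2 : ℕ) : ℝ) ^ (k + 2) + 1) := by rw [hE]; push_cast; ring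
      _ ≤ 2 * ((B ^ 3) ^ (k + 2) + 1) := by gcongr
      _ ≤ 2 ^ 2 * (B ^ 3) ^ (k + 2) := by linarith
      _ ≤ B ^ 2 * (B ^ 3) ^ (k + 2) := by gcongr
      _ = B ^ (3 * k + 8) := by ring
  have hlin : ((9 * k + 12 : ℕ) : ℝ) ≤ B ^ (5 * k) := by
    have h1 : 9 * k + 12 ≤ 32 ^ k := by
      clear * - hk
      induction k, hk using Nat.le_induction with
      | base => norm_num
      | succ m hm ih => rw [pow_succ]; omega
    calc ((9 * k + 12 : ℕ) : ℝ) ≤ ((32 ^ k : ℕ) : ℝ) := by exact_mod_cast h1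
      _ = 2 ^ (5 * k) := by rw [pow_mul]; norm_num
      _ ≤ B ^ (5 * k) := by gcongr
  have hB2 : B ≤ (2 : ℝ) ^ B := by
    have h1 := one_add_mul_self_le_rpow_one_add (s := 1) (by norm_num) hB1
    have h2 : (1 : ℝ) + 1 = 2 := by norm_num
    rw [h2] at h1
    linarith
  calc (((8 * ((n + 2) ^ (k + 1)) ^ 3) ^ E : ℕ) : ℝ)
      = ((8 * ((n + 2) ^ (k + 1)) ^ 3 : ℕ) : ℝ) ^ E := by push_cast; ring
    _ ≤ (B ^ (9 * k + 12)) ^ E := by gcongr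
    _ ≤ (((2 : ℝ) ^ B) ^ (9 * k + 12)) ^ E := by gcongr
    _ = (2 : ℝ) ^ (B * (9 * k + 12 : ℕ) * E) := by
        rw [Real.rpow_mul (by norm_num), Real.rpow_mul (by norm_num), Real.rpow_natCast,
          Real.rpow_natCast]
    _ ≤ (2 : ℝ) ^ (B * B ^ (5 * k) * B ^ (3 * k + 8)) := by
        apply Real.rpow_le_rpow_of_exponent_le (by norm_num)
        gcongr
    _ = (2 : ℝ) ^ (B ^ (8 * k + 9)) := by congr 1; ring
    _ ≤ (2 : ℝ) ^ (B ^ (17 * k)) := by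
        apply Real.rpow_le_rpow_of_exponent_le (by norm_num)
        exact pow_le_pow_right₀ hB1 (by omega)

theorem IsScattering.length_le {V : Type*} [Finite V] {G : SimpleGraph V} {w : Sym2 V → ℝ≥0}
    {P F : Set V} {ε : ℝ} (hε : 0 < ε) (hε1 : ε < 1) {k : ℕ} (hG : G.treewidth ≤ k) {l : ℕ}
    {x p : Fin l → V} (h : IsScattering P F (G.weightedDist w) ε x p) :
    (l : ℝ) ≤ (2 : ℝ) ^ ((2 / ε) ^ (17 * k)) := by
  rcases Nat.eq_zero_or_pos k with rfl | hk
  · simpa using (Nat.cast_le (α := ℝ)).2 (h.length_le_two hG)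
  obtain ⟨m, D, hD⟩ := SimpleGraph.exists_treeDecomposition_of_treewidth_le hG
  obtain ⟨H⟩ := SimpleGraph.exists_gatedHierarchy w D hD
  have hB : 2 < 2 / ε := by rw [lt_div_iff₀ hε]; linarith
  have hn0 : ⌈3 / ε⌉₊ ≠ 0 := (Nat.ceil_pos.2 (by positivity)).ne'
  have hn : ((⌈3 / ε⌉₊ : ℕ) : ℝ) + 2 ≤ 3 * (2 / ε) := by
    have h1 := Nat.ceil_lt_add_one (a := 3 / ε) (by positivity)
    have h2 : 3 / ε = 3 / 2 * (2 / ε) := by ring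
    linarith
  have hfar : 1 + 3 * ((⌈3 / ε⌉₊ : ℕ) : ℝ≥0∞)⁻¹ ≤ ENNReal.ofReal (1 + ε) := by
    have hpos : (0 : ℝ) < (⌈3 / ε⌉₊ : ℕ) := by exact_mod_cast Nat.pos_of_ne_zero hn0
    have h1 : 3 * ((⌈3 / ε⌉₊ : ℕ) : ℝ)⁻¹ ≤ ε := by
      have := Nat.le_ceil (3 / ε)
      rw [div_le_iff₀ hε] at this
      rw [← div_eq_mul_inv, div_le_iff₀ hpos]
      linarith
    rw [← ENNReal.ofReal_natCast, ← ENNReal.ofReal_inv_of_pos hpos,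
      ENNReal.ofReal_add zero_le_one hε.le, ENNReal.ofReal_one]
    gcongr
    rw [show (3 : ℝ≥0∞) = ENNReal.ofReal 3 by simp, ← ENNReal.ofReal_mul (by norm_num)]
    exact ENNReal.ofReal_le_ofReal h1
  have hlt := length_lt_of_gatedHierarchy (G.isPseudoEDist_weightedDist w) H hn0 h.covering
    fun i => hfar.trans_lt (h.refutation i)
  exact (Nat.cast_le.2 hlt.le).trans (two_rpow_bound hB hk hn)

theorem theorem1p3 :
    ∃ C : ℕ, ∀ (ε : ℝ), 0 < ε → ε < 1 → ∀ (tw : ℕ) (V : Type*) [Finite V]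
      (G : SimpleGraph V) (w : Sym2 V → ℝ≥0) (P F : Set V), G.treewidth ≤ (tw : ℕ∞) →
      ((scatterDim P F (G.weightedDist w) ε : ℕ∞) : ℝ≥0∞)
          ≤ ENNReal.ofReal (Real.exp ((2 / ε) ^ (C * tw))) ∧
      ((scatterDim P F (G.weightedDist w) ε : ℕ∞) : ℝ≥0∞)
          ≤ ENNReal.ofReal (((max tw 2 : ℕ) : ℝ) ^ ((2 / ε) ^ (C * tw) : ℝ)) := by
  refine ⟨17, fun ε hε hε1 tw V _ G w P F hG => ?_⟩
  have hE : 0 ≤ (2 / ε) ^ (17 * tw) := by positivity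
  have hdim : ((scatterDim P F (G.weightedDist w) ε : ℕ∞) : ℝ≥0∞) ≤
      ENNReal.ofReal ((2 : ℝ) ^ ((2 / ε) ^ (17 * tw))) := by
    have h1 : scatterDim P F (G.weightedDist w) ε ≤
        ((⌊(2 : ℝ) ^ ((2 / ε) ^ (17 * tw))⌋₊ : ℕ) : ℕ∞) := by
      refine iSup₂_le fun l hl => ?_
      obtain ⟨x, p, h⟩ := hl
      exact Nat.cast_le.2 (Nat.le_floor (h.length_le hε hε1 hG))
    calc ((scatterDim P F (G.weightedDist w) ε : ℕ∞) : ℝ≥0∞)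
        ≤ ((((⌊(2 : ℝ) ^ ((2 / ε) ^ (17 * tw))⌋₊ : ℕ) : ℕ∞)) : ℝ≥0∞) := ENat.toENNReal_le.2 h1
      _ = ENNReal.ofReal ((⌊(2 : ℝ) ^ ((2 / ε) ^ (17 * tw))⌋₊ : ℕ) : ℝ) := by simp
      _ ≤ _ := ENNReal.ofReal_le_ofReal (Nat.floor_le (by positivity))
  refine ⟨hdim.trans (ENNReal.ofReal_le_ofReal ?_), hdim.trans (ENNReal.ofReal_le_ofReal ?_)⟩
  · rw [← Real.exp_one_rpow]
    refine Real.rpow_le_rpow (by norm_num) ?_ hE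
    linarith [Real.add_one_le_exp (1 : ℝ)]
  · refine Real.rpow_le_rpow (by norm_num) ?_ hE
    exact_mod_cast le_max_right tw 2
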